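/- Let $h\ge 0$ be an integer, let $q=3^{2h+1}$ and $\alpha=3^{h+1}$, and let $\mathbb F_q$ be the finite field with $q$ elements. For $a\in\mathbb F_q$ put $$f_a(x)=x^{2\alpha+3}+(ax)^{\alpha}-a^2x .$$ Then for every nonzero $a\in\mathbb F_q$ the set $$D_a=\{f_a(x^2) : x\in\mathbb F_q,\ x\neq 0\}$$ is a skew Hadamard difference set in the additive group $(\mathbb F_q,+)$. That is, there is an integer $\lambda\ge 0$ such that every nonzero $g\in\mathbb F_q$ can be written as $g=y-z$ with $y,z\in D_a$ in exactly $\lambda$ ways (so $D_a$ is a difference set), and $\mathbb F_q$ is the disjoint union of $D_a$, $-D_a=\{-d : d\in D_a\}$ and $\{0\}$. -/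

import Mathlib

open scoped Pointwise

/-- `D` is a `(v, k, l)` difference set in the finite (additively written) group `G` of order `v`:
it has `k` elements, and the list of differences `x - y` with `x, y ∈ D`, `x ≠ y` represents every
nonzero element of `G` exactly `l` times. -/
structure IsDifferenceSet {G : Type*} [AddGroup G] [Finite G] (D : Set G) (v k l : ℕ) : Prop where
  card_group : Nat.card G = v
  card_set : D.ncard = k
  card_repr : ∀ g : G, g ≠ 0 →
    {p : G × G | p.1 ∈ D ∧ p.2 ∈ D ∧ p.1 ≠ p.2 ∧ p.1 - p.2 = g}.ncard = l

/-- `D` is a skew Hadamard difference set in the finite (additively written) group `G`: it is a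
difference set, and `G` is the disjoint union of `D`, `-D` and `{0}`. -/
structure IsSkewHadamardDifferenceSet {G : Type*} [AddGroup G] [Finite G] (D : Set G) : Prop where
  isDifferenceSet : ∃ v k l : ℕ, IsDifferenceSet D v k l
  disjoint_neg : Disjoint D (-D)
  zero_notMem : (0 : G) ∉ D
  union_eq : D ∪ -D ∪ {0} = Set.univ

/-- The map `f_a(x) = x ^ (2 α + 3) + (a x) ^ α - a ^ 2 x`. -/
def reeTitsMap {F : Type*} [Field F] (α : ℕ) (a x : F) : F :=
  x ^ (2 * α + 3) + (a * x) ^ α - a ^ 2 * x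

/-- The set `D_a = {f_a(x ^ 2) : x ∈ F, x ≠ 0}`. -/
def reeTitsSet {F : Type*} [Field F] (α : ℕ) (a : F) : Set F :=
  {y | ∃ x : F, x ≠ 0 ∧ reeTitsMap α a (x ^ 2) = y}

/-!
`f_a` is an odd permutation of `F`. With `σ = x ↦ x ^ 3 ^ (h + 1)`, so that `σ ∘ σ` is the Frobenius
map, `f_a x = x ^ 3 * σ x ^ 2 + σ (a * x) - a ^ 2 * x`, and a collision of two values gives, after
rescaling, an equation `σ A = A ^ 2 - 1 - σ r ^ 2 + σ r * r ^ 3`; eliminating `σ A` between it and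
its image under `σ` leaves a product of two factors, and the vanishing of either forces
`A = 0`. As `-1` is not a square, the image `D_a` of the nonzero squares contains exactly one of
`u`, `-u` for `u ≠ 0`.

For a nontrivial additive character `ψ` of `F` with values in a domain containing a cube root of
unity `ω`, put `ψ(D) = ∑ d ∈ D, ψ d`. Then `ψ(D_a) - ψ(-D_a) = N * (ω - ω ^ 2)` for an integer `N`,
which is odd, and `D_a` is a difference set as soon as `N ^ 2 = 3 ^ (2 * h)` for every `ψ`. By
Parseval, `3 ^ (2 * h)` is the mean of `N ^ 2` over the nontrivial `ψ`, so it is enough that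
`3 ^ h` divides `N`, that is, that `(ω - 1) ^ (2 * h + 1)` divides `ψ(D_a) - ψ(-D_a)`.

This difference is the sum over `y` of `η y * ψ (f_a y)` with `η` the quadratic character. As `ψ` is
`σ`-invariant, it becomes a sum of `η y * ψ (β * y ^ (3 ^ (h + 1) + 2) + γ * y)`, and expanding `ψ`
in multiplicative characters turns it into a combination of products of two Gauss sums. By
Stickelberger's theorem a Gauss sum is divisible by `ω - 1` to the power given by the ternary digit
sum of its exponent, and the required bound on these digit sums follows from an analysis of the
carries in an addition modulo `q - 1`.
-/

/-! ### Injectivity of `f_a` -/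

section Injectivity

variable {F : Type*} [Field F] [CharP F 3]

theorem reeTits_factor_mul_factor_eq_zero {A B R c : F} (hB : B = A ^ 2 - 1 - R ^ 2 + R * c)
    (hA : A ^ 3 = B ^ 2 - 1 - c ^ 2 + c * R ^ 3) :
    ((R + 1) * (A + (R + c)) + A ^ 2) * ((-R + 1) * (A + (-R + -c)) + A ^ 2) = 0 := by
  have h3 : (3 : F) = 0 := CharP.ofNat_eq_zero F 3
  linear_combination -hA - (B + (A ^ 2 - 1 - R ^ 2 + R * c)) * hB +
    (A ^ 3 + (1 + R ^ 2) * A ^ 2 - R ^ 2 + R ^ 3 * c) * h3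

theorem eq_zero_of_reeTits_factor_eq_zero {A B R c : F} (hB : B = A ^ 2 - 1 - R ^ 2 + R * c)
    (hBA : B = 0 → A = 0) (hA : (R + 1) * (A + (R + c)) + A ^ 2 = 0)
    (hσA : (c + 1) * (B + (c + R ^ 3)) + B ^ 2 = 0) : A = 0 := by
  have h3 : (3 : F) = 0 := CharP.ofNat_eq_zero F 3
  obtain ⟨P, rfl⟩ : ∃ P, R = P - 1 := ⟨R + 1, by ring⟩
  obtain ⟨C, rfl⟩ : ∃ C, c = C - 1 := ⟨c + 1, by ring⟩
  by_cases hP : P = 0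
  · subst hP
    exact pow_eq_zero_iff two_ne_zero |>.1 (by linear_combination hA)
  have hPC : P * C = -((A - P) ^ 2 + P) := by linear_combination hA + (P - P * A) * h3
  have hBC : B = P ^ 2 - A * P - 1 - C := by
    linear_combination hB + hPC + (A * P - P ^ 2) * h3
  have hPB : P * B = (A - P) * (A - P - P ^ 2) := by linear_combination P * hBC - hPC
  have hCB : C * P * (P - A + P ^ 2) + B ^ 2 = 0 := by
    linear_combination hσA - C * hBC + (C + C * P ^ 2 - C * P) * h3
  have hprod : (A - P - P ^ 2) * A ^ 3 = 0 := by
    linear_combination P ^ 2 * hCB + P ^ 2 * (A - P - P ^ 2) * hPC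
      - (P * B + (A - P) * (A - P - P ^ 2)) * hPB
      + (A - P - P ^ 2) * A * P * (A - P) * h3
  rcases mul_eq_zero.1 hprod with hfactor | hcube
  · rw [hfactor, mul_zero] at hPB
    exact hBA ((mul_eq_zero.1 hPB).resolve_left hP)
  · exact pow_eq_zero_iff three_ne_zero |>.1 hcube

variable (σ : F →+* F) (hσ : ∀ x, σ (σ x) = x ^ 3)

include hσ

theorem eq_zero_of_map_eq_sq_sub {A r : F}
    (h : σ A = A ^ 2 - 1 - σ r ^ 2 + σ r * r ^ 3) : A = 0 := by
  have eq_zero_of_factor (r : F) (h : σ A = A ^ 2 - 1 - σ r ^ 2 + σ r * r ^ 3)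
      (hfactor : (σ r + 1) * (A + (σ r + r ^ 3)) + A ^ 2 = 0) : A = 0 := by
    refine eq_zero_of_reeTits_factor_eq_zero h (map_eq_zero σ).1 hfactor ?_
    simpa [hσ] using congrArg σ hfactor
  have hA : A ^ 3 = σ A ^ 2 - 1 - (r ^ 3) ^ 2 + r ^ 3 * σ r ^ 3 := by
    simpa only [map_sub, map_add, map_mul, map_pow, map_one, hσ] using congrArg σ h
  rcases mul_eq_zero.1 (reeTits_factor_mul_factor_eq_zero h hA) with hpos | hneg
  · exact eq_zero_of_factor r h hpos
  · refine eq_zero_of_factor (-r) ?_ ?_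
    · rw [map_neg, h]; ring
    · rw [map_neg, ← hneg]; ring

theorem injective_cube_mul_map_sq_add_map_mul_sub {a : F} (ha : a ≠ 0) :
    Function.Injective fun x => x ^ 3 * σ x ^ 2 + σ (a * x) - a ^ 2 * x := by
  intro x y hxy
  by_contra hne
  have h3 : (3 : F) = 0 := CharP.ofNat_eq_zero F 3
  obtain ⟨p, hpxy⟩ : ∃ p, p = x - y := ⟨_, rfl⟩
  have hp : p ≠ 0 := hpxy ▸ sub_ne_zero.2 hne
  have hσp : σ p ≠ 0 := (map_ne_zero σ).2 hp
  -- Since `2 = -1`, the points are `x = p (r - 1)` and `y = p (r + 1)`; scaling `a` by `p σ(p)`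
  -- then cancels `p` from the equation.
  obtain ⟨r, hr⟩ : ∃ r, p * r = -(x + y) := ⟨-(x + y) / p, by field_simp⟩
  obtain ⟨A, rfl⟩ : ∃ A, a = A * (p * σ p) := ⟨a / (p * σ p), by field_simp⟩
  obtain rfl : x = p * (r - 1) := by linear_combination x * h3 - hr + hpxy
  obtain rfl : y = p * (r + 1) := by linear_combination y * h3 - hr - hpxy
  refine left_ne_zero_of_mul ha (eq_zero_of_map_eq_sq_sub σ hσ (r := r) ?_)
  simp only [map_mul, map_add, map_sub, map_one, hσ] at hxy
  refine mul_left_cancel₀ (mul_ne_zero (pow_ne_zero 3 hp) (pow_ne_zero 2 hσp)) ?_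
  linear_combination hxy + p ^ 3 * σ p ^ 2 * (σ A - A ^ 2 + 1 + σ r ^ 2 + r ^ 3 * σ r
    + 2 * r ^ 2 * (σ r ^ 2 + 1) + 4 * r * σ r) * h3

end Injectivity

section ReeTitsMap

variable {F : Type*} [Field F]

theorem reeTitsMap_zero {α : ℕ} (hα : α ≠ 0) (a : F) : reeTitsMap α a 0 = 0 := by
  simp [reeTitsMap, hα]

theorem reeTitsMap_neg {α : ℕ} (hα : Odd α) (a x : F) :
    reeTitsMap α a (-x) = -reeTitsMap α a x := by
  have hodd : Odd (2 * α + 3) := (even_two_mul α).add_odd (by decide)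
  simp only [reeTitsMap, mul_neg, hodd.neg_pow, hα.neg_pow]
  ring

variable [CharP F 3]

theorem reeTitsMap_three_pow (k : ℕ) (a x : F) :
    reeTitsMap (3 ^ k) a x =
      x ^ 3 * iterateFrobenius F 3 k x ^ 2 + iterateFrobenius F 3 k (a * x) - a ^ 2 * x := by
  simp only [reeTitsMap, iterateFrobenius_def]
  ring

end ReeTitsMap

theorem iterateFrobenius_iterateFrobenius_of_card {F : Type*} [Field F] [Finite F] {p : ℕ}
    [Fact p.Prime] [CharP F p] {h : ℕ} (hq : Nat.card F = p ^ (2 * h + 1)) (x : F) :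
    iterateFrobenius F p (h + 1) (iterateFrobenius F p (h + 1) x) = x ^ p := by
  have := Fintype.ofFinite F
  rw [iterateFrobenius_def, iterateFrobenius_def, ← pow_mul, ← pow_add,
    show h + 1 + (h + 1) = (2 * h + 1) + 1 by ring, pow_succ, ← hq, pow_mul,
    Nat.card_eq_fintype_card, FiniteField.pow_card]

theorem reeTitsMap_injective {F : Type*} [Field F] [Finite F] [CharP F 3] {h : ℕ}
    (hq : Nat.card F = 3 ^ (2 * h + 1)) {a : F} (ha : a ≠ 0) :
    Function.Injective (reeTitsMap (3 ^ (h + 1)) a) := by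
  have hinj := injective_cube_mul_map_sq_add_map_mul_sub (iterateFrobenius F 3 (h + 1))
    (iterateFrobenius_iterateFrobenius_of_card hq) ha
  exact funext (reeTitsMap_three_pow (h + 1) a) ▸ hinj

/-! ### Digit sums and the Welch exponent -/

theorem sum_range_pow_add_of_pow_eq_one {M A : Type*} [Monoid M] [AddCancelCommMonoid A] {b : M}
    {m : ℕ} (hb : b ^ m = 1) (f : M → A) (t : ℕ) :
    ∑ k ∈ Finset.range m, f (b ^ (k + t)) = ∑ k ∈ Finset.range m, f (b ^ k) := by
  induction t with
  | zero => rfl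
  | succ t ih =>
    rw [← ih]
    have hshift := (Finset.sum_range_succ' (fun k => f (b ^ (k + t))) m).symm.trans
      (Finset.sum_range_succ _ m)
    rw [pow_add b m, hb, one_mul, zero_add] at hshift
    simpa only [add_assoc, add_comm 1 t] using add_right_cancel hshift

theorem val_natCast_mul {n : ℕ} (c : ℕ) (y : ZMod n) :
    ((c : ZMod n) * y).val = c * y.val % n := by
  rw [ZMod.val_mul, ZMod.val_natCast, Nat.mod_mul_mod]

/-- The leading digit of a residue modulo `b ^ m - 1`, represented in `[0, b ^ m - 1)` and written
with `m` digits in base `b`. The definition does not mention `m`: for `n = b ^ m - 1` and `y < n`,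
the leading digit `⌊y / b ^ (m - 1)⌋` equals `⌊b * y / n⌋`. -/
def leadingDigit (b : ℕ) {n : ℕ} (y : ZMod n) : ℕ := b * y.val / n

/-- The sum of the `m` base-`b` digits of a residue modulo `n = b ^ m - 1`: multiplication by `b`
rotates the digits cyclically, so each of them is the leading digit of some `b ^ k * y`. -/
def digitSum (b m : ℕ) {n : ℕ} (y : ZMod n) : ℕ :=
  ∑ k ∈ Finset.range m, leadingDigit b ((b : ZMod n) ^ k * y)

section Digits

variable {b m n : ℕ}

theorem digitSum_zero : digitSum b m (0 : ZMod n) = 0 := by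
  simp [digitSum, leadingDigit]

theorem mul_leadingDigit_add_val (y : ZMod n) :
    n * leadingDigit b y + (b * y).val = b * y.val := by
  rw [val_natCast_mul, leadingDigit, Nat.div_add_mod]

variable [NeZero n]

theorem leadingDigit_lt (hb : 0 < b) (y : ZMod n) : leadingDigit b y < b :=
  Nat.div_lt_of_lt_mul (by rw [mul_comm n]; exact Nat.mul_lt_mul_of_pos_left y.val_lt hb)

theorem leadingDigit_add_leadingDigit_neg (hb : IsUnit (b : ZMod n)) {y : ZMod n} (hy : y ≠ 0) :
    leadingDigit b y + leadingDigit b (-y) + 1 = b := by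
  have : NeZero y := ⟨hy⟩
  have : NeZero (b * y) := ⟨fun h => hy (hb.mul_right_eq_zero.1 h)⟩
  have hdigit := mul_leadingDigit_add_val (b := b) y
  have hdigit_neg := mul_leadingDigit_add_val (b := b) (-y)
  rw [mul_neg, ZMod.val_neg_of_ne_zero, ZMod.val_neg_of_ne_zero] at hdigit_neg
  have hlt := y.val_lt.le
  have hlt' := ((b : ZMod n) * y).val_lt.le
  refine Nat.eq_of_mul_eq_mul_left (NeZero.pos n) ?_
  zify [hlt, hlt'] at hdigit hdigit_neg ⊢
  linear_combination hdigit + hdigit_neg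

theorem digitSum_add_digitSum_neg (hb : IsUnit (b : ZMod n)) {y : ZMod n} (hy : y ≠ 0) :
    digitSum b m y + digitSum b m (-y) = (b - 1) * m := by
  have hdigit (k : ℕ) : leadingDigit b ((b : ZMod n) ^ k * y) +
      leadingDigit b ((b : ZMod n) ^ k * -y) = b - 1 := by
    rw [mul_neg]
    exact Nat.eq_sub_of_add_eq (leadingDigit_add_leadingDigit_neg hb fun h =>
      hy ((hb.pow k).mul_right_eq_zero.1 h))
  rw [digitSum, digitSum, ← Finset.sum_add_distrib, Finset.sum_congr rfl fun k _ => hdigit k,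
    Finset.sum_const, Finset.card_range, smul_eq_mul, mul_comm]

theorem pow_succ_mul_val_div (y : ZMod n) (t : ℕ) :
    b ^ (t + 1) * y.val / n = b * (b ^ t * y.val / n) + leadingDigit b ((b : ZMod n) ^ t * y) := by
  rw [leadingDigit, ← Nat.cast_pow, val_natCast_mul, pow_succ', mul_assoc]
  conv_lhs => rw [← Nat.div_add_mod (b ^ t * y.val) n, mul_add, mul_left_comm]
  rw [Nat.mul_add_div (NeZero.pos n)]

end Digits

section Welch

variable {n m : ℕ} {α y z : ZMod n}

theorem two_mul_half (hn : Even n) : (2 : ZMod n) * (n / 2 : ℕ) = 0 := by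
  rw [← Nat.cast_ofNat, ← Nat.cast_mul, Nat.two_mul_div_two_of_even hn, ZMod.natCast_self]

theorem three_pow_mul_half (hn : Even n) (k : ℕ) :
    (3 : ZMod n) ^ k * (n / 2 : ℕ) = (n / 2 : ℕ) := by
  induction k with
  | zero => rw [pow_zero, one_mul]
  | succ k ih => linear_combination 3 * ih + two_mul_half hn

theorem welch_relation_three_pow_mul (hn : Even n) (h : α * y + 2 * y + z = (n / 2 : ℕ)) (k : ℕ) :
    α * (3 ^ k * y) + 2 * (3 ^ k * y) + 3 ^ k * z = (n / 2 : ℕ) := by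
  linear_combination (3 : ZMod n) ^ k * h + three_pow_mul_half hn k

/-- The carry out of the leading place in the addition `α y + 2 y + z ≡ n / 2` of residues
modulo `n = 3 ^ m - 1`, all represented in `[0, n)`. All ternary digits of `n / 2` are equal
to `1`. -/
def carry (α y z : ZMod n) : ℤ :=
  (((α * y).val + 2 * y.val + z.val : ℤ) - (n / 2 : ℕ)) / n

/-- The potential absorbing the places at which the leading digit of `y` exceeds the carry. -/
def carryPotential (α y z : ZMod n) : ℤ :=
  if leadingDigit 3 y = 2 ∨ (leadingDigit 3 y = 1 ∧ 1 ≤ carry α (α * y) (α * z)) then 1 else 0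

variable [NeZero n]

theorem mul_carry (h : α * y + 2 * y + z = (n / 2 : ℕ)) :
    n * carry α y z = (α * y).val + 2 * y.val + z.val - (n / 2 : ℕ) := by
  refine Int.mul_ediv_cancel' ((ZMod.intCast_zmod_eq_zero_iff_dvd _ _).1 ?_)
  rw [Int.cast_sub, Int.cast_natCast, ← h]
  push_cast
  simp only [ZMod.natCast_val, ZMod.cast_id', id_eq, sub_self]

theorem carry_nonneg (h : α * y + 2 * y + z = (n / 2 : ℕ)) : 0 ≤ carry α y z := by
  have hn : (0 : ℤ) < n := by exact_mod_cast NeZero.pos n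
  have hlt : (n : ℤ) * -1 < n * carry α y z := by
    rw [mul_carry h]
    omega
  exact Int.add_one_le_iff.2 (lt_of_mul_lt_mul_left hlt hn.le)

theorem three_mul_carry (hn : Even n) (h : α * y + 2 * y + z = (n / 2 : ℕ)) :
    3 * carry α y z = carry α (3 * y) (3 * z) + leadingDigit 3 (α * y)
      + 2 * leadingDigit 3 y + leadingDigit 3 z - 1 := by
  have hcarry := mul_carry h
  have hcarry_three := mul_carry (α := α) (y := 3 * y) (z := 3 * z)
    (by simpa only [pow_one] using welch_relation_three_pow_mul hn h 1)
  rw [mul_left_comm α] at hcarry_three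
  have hαy := mul_leadingDigit_add_val (b := 3) (α * y)
  have hy := mul_leadingDigit_add_val (b := 3) y
  have hz := mul_leadingDigit_add_val (b := 3) z
  have hhalf : 2 * ((n / 2 : ℕ) : ℤ) = n := by exact_mod_cast Nat.two_mul_div_two_of_even hn
  zify at hαy hy hz
  refine mul_left_cancel₀ (Int.natCast_ne_zero.2 (NeZero.ne n)) ?_
  linear_combination 3 * hcarry - hcarry_three - hαy - 2 * hy - hz - hhalf

theorem leadingDigit_le_carry_add_potential (hn : Even n) (hα : α * α = 3)
    (h : α * y + 2 * y + z = (n / 2 : ℕ))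
    (h' : α * (α * y) + 2 * (α * y) + α * z = (n / 2 : ℕ)) :
    (leadingDigit 3 y : ℤ) ≤
      carry α y z + carryPotential α y z - carryPotential α (α * y) (α * z) := by
  have hαα (w : ZMod n) : α * (α * w) = 3 * w := by rw [← mul_assoc, hα]
  have hcarry := three_mul_carry hn h
  have hcarry' := three_mul_carry hn h'
  have hc := carry_nonneg h
  have hc' := carry_nonneg h'
  have hc_three : 0 ≤ carry α (3 * y) (3 * z) :=
    carry_nonneg (by simpa only [pow_one] using welch_relation_three_pow_mul hn h 1)
  have hc'_three : 0 ≤ carry α (3 * (α * y)) (3 * (α * z)) :=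
    carry_nonneg (by simpa only [pow_one] using welch_relation_three_pow_mul hn h' 1)
  have hy := leadingDigit_lt three_pos y
  have hαy := leadingDigit_lt three_pos (α * y)
  simp only [carryPotential, hαα] at *
  split_ifs <;> omega

theorem two_mul_sum_carry (hn : Even n) (h3 : (3 : ZMod n) ^ m = 1) {t : ℕ}
    (h : 3 ^ t * y + 2 * y + z = (n / 2 : ℕ)) :
    2 * ∑ k ∈ Finset.range m, carry (3 ^ t) (3 ^ k * y) (3 ^ k * z) =
      3 * digitSum 3 m y + digitSum 3 m z - m := by
  have hrec (k : ℕ) : 3 * carry (3 ^ t) (3 ^ k * y) (3 ^ k * z) =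
      carry (3 ^ t) (3 ^ (k + 1) * y) (3 ^ (k + 1) * z) + leadingDigit 3 (3 ^ (k + t) * y)
        + 2 * leadingDigit 3 (3 ^ k * y) + leadingDigit 3 (3 ^ k * z) - 1 := by
    rw [three_mul_carry hn (welch_relation_three_pow_mul hn h k)]
    ring_nf
  have hsum := Finset.sum_congr rfl fun k (_ : k ∈ Finset.range m) => hrec k
  simp only [Finset.sum_sub_distrib, Finset.sum_add_distrib, ← Finset.mul_sum, Finset.sum_const,
    Finset.card_range, nsmul_eq_mul, mul_one,
    sum_range_pow_add_of_pow_eq_one h3 fun u => carry (3 ^ t) (u * y) (u * z),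
    sum_range_pow_add_of_pow_eq_one h3 fun u => (leadingDigit 3 (u * y) : ℤ)] at hsum
  simp only [digitSum]
  push_cast
  linear_combination hsum

theorem digitSum_le_sum_carry (hn : Even n) (h3 : (3 : ZMod n) ^ m = 1) {t : ℕ}
    (ht : (3 : ZMod n) ^ t * 3 ^ t = 3) (h : 3 ^ t * y + 2 * y + z = (n / 2 : ℕ)) :
    (digitSum 3 m y : ℤ) ≤ ∑ k ∈ Finset.range m, carry (3 ^ t) (3 ^ k * y) (3 ^ k * z) := by
  have hle (k : ℕ) : (leadingDigit 3 (3 ^ k * y) : ℤ) ≤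
      carry (3 ^ t) (3 ^ k * y) (3 ^ k * z) + carryPotential (3 ^ t) (3 ^ k * y) (3 ^ k * z)
        - carryPotential (3 ^ t) (3 ^ (k + t) * y) (3 ^ (k + t) * z) := by
    have hmul (w : ZMod n) : 3 ^ (k + t) * w = 3 ^ t * (3 ^ k * w) := by ring
    rw [hmul, hmul]
    refine leadingDigit_le_carry_add_potential hn ht (welch_relation_three_pow_mul hn h k) ?_
    rw [← hmul, ← hmul]
    exact welch_relation_three_pow_mul hn h _
  have hsum := Finset.sum_le_sum fun k (_ : k ∈ Finset.range m) => hle k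
  rw [Finset.sum_sub_distrib, Finset.sum_add_distrib,
    sum_range_pow_add_of_pow_eq_one h3 fun u => carryPotential (3 ^ t) (u * y) (u * z)] at hsum
  simp only [digitSum]
  push_cast
  linarith

theorem le_digitSum_add_digitSum (hn : Even n) (h3 : (3 : ZMod n) ^ m = 1) {t : ℕ}
    (ht : (3 : ZMod n) ^ t * 3 ^ t = 3) (h : 3 ^ t * y + 2 * y + z = (n / 2 : ℕ)) :
    m ≤ digitSum 3 m y + digitSum 3 m z := by
  have hsum := two_mul_sum_carry hn h3 h
  have hle := digitSum_le_sum_carry hn h3 ht h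
  omega

end Welch

/-! ### The absolute trace -/

theorem sum_inv_mul_pow_eq_zero {F : Type*} [Field F] [Fintype F] {j : ℕ} (h1 : 1 < j)
    (hj : j < Fintype.card F) : ∑ x : F, x⁻¹ * x ^ j = 0 := by
  rw [← FiniteField.sum_pow_lt_card_sub_one F (j - 1) (by lia)]
  refine Finset.sum_congr rfl fun x _ => ?_
  obtain ⟨i, rfl⟩ := Nat.exists_eq_add_of_lt h1
  rcases eq_or_ne x 0 with rfl | hx
  · simp
  · rw [pow_succ', inv_mul_cancel_left₀ hx, Nat.add_sub_cancel]

section Trace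

variable (p : ℕ) (F : Type*) [Field F] [CharP F p]

/-- The absolute trace `F → 𝔽_p` of a field of characteristic `p`, as an additive map. -/
noncomputable def absTrace : F →+ ZMod p :=
  letI := ZMod.algebra F p
  (Algebra.trace (ZMod p) F).toAddMonoidHom

variable {F} [Fact p.Prime]

theorem absTrace_pow_pow [Finite F] (k : ℕ) (x : F) :
    absTrace p F (x ^ p ^ k) = absTrace p F x := by
  let := ZMod.algebra F p
  induction k with
  | zero => rw [pow_zero, pow_one]
  | succ k ih =>
    rw [← ih, pow_succ, pow_mul]
    have h := Algebra.trace_eq_of_algEquiv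
      (FiniteField.frobeniusAlgEquivOfAlgebraic (ZMod p) F) (x ^ p ^ k)
    rwa [FiniteField.coe_frobeniusAlgEquivOfAlgebraic, ZMod.card] at h

variable {p} [Fintype F] {m : ℕ}

theorem cast_absTrace (hq : Fintype.card F = p ^ m) (x : F) :
    ((absTrace p F x).val : F) = ∑ i ∈ Finset.range m, x ^ p ^ i := by
  let := ZMod.algebra F p
  have hm : Module.finrank (ZMod p) F = m := by
    refine Nat.pow_right_injective (Fact.out : p.Prime).two_le (Eq.trans ?_ hq)
    rw [Module.card_eq_pow_finrank (K := ZMod p) (V := F), ZMod.card]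
  have htrace := FiniteField.algebraMap_trace_eq_sum_pow (ZMod p) F x
  rw [hm, Nat.card_zmod] at htrace
  rw [← htrace, ← map_natCast (algebraMap (ZMod p) F), ZMod.natCast_zmod_val]
  rfl

variable (p F) in
theorem sum_inv_mul_absTrace : ∑ x : F, x⁻¹ * ((absTrace p F x).val : F) = -1 := by
  classical
  obtain ⟨m, -, hq⟩ := FiniteField.card F p
  have hp := (Fact.out : p.Prime).one_lt
  have hself (x : F) : x⁻¹ * x ^ p ^ 0 = 1 - if x = 0 then 1 else 0 := by
    by_cases hx : x = 0 <;> simp [hx]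
  simp only [cast_absTrace hq, Finset.mul_sum]
  rw [Finset.sum_comm, Finset.sum_eq_single_of_mem 0 (Finset.mem_range.2 m.pos)]
  · simp only [hself, Finset.sum_sub_distrib, Finset.sum_ite_eq', Finset.mem_univ, if_true]
    simp
  · exact fun i hi hi0 => sum_inv_mul_pow_eq_zero (Nat.one_lt_pow hi0 hp)
      (hq ▸ Nat.pow_lt_pow_right hp (Finset.mem_range.1 hi))

end Trace

/-! ### Cyclotomic extensions of Witt vectors -/

/-- A ring `R` containing a primitive `p`-th root of unity `ω = omega`, with a residue map `res`
onto the field `F` whose kernel is generated by `ω - 1`, and with multiplicative representatives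
`tau` of the residue classes. This is the setting of Stickelberger's theorem: Gauss sums of `F`
have values in `R`, and their divisibility by powers of `ω - 1` is at stake. -/
structure CyclotomicTeichmullerRing (p : ℕ) (F R : Type*) [Field F] [CommRing R] where
  res : R →+* F
  tau : F →*₀ R
  omega : R
  res_tau : ∀ x, res (tau x) = x
  isPrimitiveRoot_omega : IsPrimitiveRoot omega p
  sub_one_dvd_of_res_eq_zero : ∀ x, res x = 0 → omega - 1 ∣ x

section Existence

universe u

theorem charZero_of_natCast_ne_zero {W F : Type*} [CommRing W] [IsDomain W] [Field F] {p : ℕ}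
    [hp : Fact p.Prime] [CharP F p] (φ : W →+* F) (hpW : (p : W) ≠ 0) : CharZero W := by
  refine charZero_of_inj_zero fun n hn => ?_
  by_contra hn0
  obtain ⟨k, l, hl, rfl⟩ := Nat.exists_eq_pow_mul_and_not_dvd hn0 p hp.out.ne_one
  push_cast at hn
  have hl0 := congrArg φ ((mul_eq_zero.1 hn).resolve_left (pow_ne_zero k hpW))
  rw [map_natCast, map_zero, CharP.cast_eq_zero_iff F p] at hl0
  exact hl hl0

open Polynomial

/-- The minimal polynomial of `ω - 1`, for `ω` a primitive `p`-th root of unity. -/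
noncomputable def shiftedCyclotomic (p : ℕ) (W : Type*) [CommRing W] : W[X] :=
  (cyclotomic p W).comp (X + 1)

section ShiftedCyclotomic

variable {p : ℕ} {W : Type*} [CommRing W]

theorem shiftedCyclotomic_eq_map :
    shiftedCyclotomic p W = (shiftedCyclotomic p ℤ).map (Int.castRingHom W) := by
  simp [shiftedCyclotomic, Polynomial.map_comp, map_cyclotomic]

theorem eval₂_shiftedCyclotomic {S : Type*} [CommRing S] (φ : W →+* S) (x : S) :
    (shiftedCyclotomic p W).eval₂ φ x = (cyclotomic p S).eval (x + 1) := by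
  simp [shiftedCyclotomic, ← eval_map, Polynomial.map_comp, map_cyclotomic]

theorem natDegree_X_add_one [Nontrivial W] : (X + 1 : W[X]).natDegree = 1 :=
  natDegree_X_add_C 1

theorem monic_shiftedCyclotomic : (shiftedCyclotomic p W).Monic := by
  nontriviality W
  exact (cyclotomic.monic p W).comp (monic_X_add_C 1) (natDegree_X_add_one.trans_ne one_ne_zero)

variable [hp : Fact p.Prime]

theorem coeff_zero_shiftedCyclotomic : (shiftedCyclotomic p W).coeff 0 = p := by
  simp [shiftedCyclotomic, coeff_zero_eq_eval_zero, eval_comp]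

theorem natDegree_shiftedCyclotomic_pos [IsDomain W] : 0 < (shiftedCyclotomic p W).natDegree := by
  rw [shiftedCyclotomic, natDegree_comp, natDegree_X_add_one, mul_one, natDegree_cyclotomic]
  exact Nat.totient_pos.2 hp.out.pos

theorem dvd_coeff_shiftedCyclotomic {i : ℕ} (hi : i < (shiftedCyclotomic p W).natDegree) :
    (p : W) ∣ (shiftedCyclotomic p W).coeff i := by
  rw [shiftedCyclotomic_eq_map] at hi ⊢
  have hmem := (cyclotomic_comp_X_add_one_isEisensteinAt p).mem
    (hi.trans_le natDegree_map_le)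
  rw [Ideal.submodule_span_eq, Ideal.mem_span_singleton] at hmem
  rw [coeff_map, ← map_natCast (Int.castRingHom W)]
  exact map_dvd _ hmem

theorem irreducible_shiftedCyclotomic [IsDomain W] (hpW : Prime (p : W)) :
    Irreducible (shiftedCyclotomic p W) := by
  have hprime := (Ideal.span_singleton_prime hpW.ne_zero).2 hpW
  refine (monic_shiftedCyclotomic.isEisensteinAt_of_mem_of_notMem hprime.ne_top
    (fun hi => Ideal.mem_span_singleton.2 (dvd_coeff_shiftedCyclotomic hi)) ?_).irreducible hprime
    monic_shiftedCyclotomic.isPrimitive ?_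
  · rw [coeff_zero_shiftedCyclotomic, Ideal.span_singleton_pow, Ideal.mem_span_singleton]
    exact fun h => hpW.not_isUnit (hpW.irreducible.squarefree _ (sq (p : W) ▸ h))
  · exact natDegree_shiftedCyclotomic_pos

end ShiftedCyclotomic

section AdjoinRoot

variable {p : ℕ} [hp : Fact p.Prime] {W : Type*} [CommRing W]

theorem root_shiftedCyclotomic_dvd_mk {f : W[X]} (h : (p : W) ∣ f.coeff 0) :
    AdjoinRoot.root (shiftedCyclotomic p W) ∣ AdjoinRoot.mk (shiftedCyclotomic p W) f := by
  have hmk (g : W[X]) : AdjoinRoot.mk (shiftedCyclotomic p W) g =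
      AdjoinRoot.mk _ g.divX * AdjoinRoot.root _ + AdjoinRoot.mk _ (C (g.coeff 0)) := by
    rw [← AdjoinRoot.mk_X, ← map_mul, ← map_add, divX_mul_X_add]
  have hp_dvd : AdjoinRoot.root (shiftedCyclotomic p W) ∣ AdjoinRoot.mk _ (C (p : W)) := by
    have hself := hmk (shiftedCyclotomic p W)
    rw [AdjoinRoot.mk_self, coeff_zero_shiftedCyclotomic] at hself
    exact (dvd_add_right (dvd_mul_left _ _)).1 (hself ▸ dvd_zero _)
  rw [hmk f]
  exact dvd_add (dvd_mul_left _ _) (hp_dvd.trans (map_dvd _ (map_dvd C h)))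

variable [IsDomain W]

theorem injective_of_shiftedCyclotomic :
    Function.Injective (AdjoinRoot.of (shiftedCyclotomic p W)) :=
  AdjoinRoot.of.injective_of_degree_ne_zero
    (natDegree_pos_iff_degree_pos.1 natDegree_shiftedCyclotomic_pos).ne'

theorem isDomain_adjoinRoot_shiftedCyclotomic [UniqueFactorizationMonoid W]
    (hpW : Prime (p : W)) : IsDomain (AdjoinRoot (shiftedCyclotomic p W)) :=
  AdjoinRoot.isDomain_of_prime (irreducible_shiftedCyclotomic hpW).prime

theorem isPrimitiveRoot_root_shiftedCyclotomic_add_one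
    [IsDomain (AdjoinRoot (shiftedCyclotomic p W))] (hpW : (p : W) ≠ 0) :
    IsPrimitiveRoot (AdjoinRoot.root (shiftedCyclotomic p W) + 1) p := by
  have : NeZero (p : AdjoinRoot (shiftedCyclotomic p W)) := ⟨fun h => hpW <|
    injective_of_shiftedCyclotomic (by rw [map_natCast, h, map_zero])⟩
  rw [← isRoot_cyclotomic_iff, IsRoot.def, ← eval₂_shiftedCyclotomic (AdjoinRoot.of _)]
  exact AdjoinRoot.eval₂_root _

variable {F : Type*} [Field F] [CharP F p]

theorem nonempty_cyclotomicTeichmullerRing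
    [IsDomain (AdjoinRoot (shiftedCyclotomic p W))] (hpW : (p : W) ≠ 0) {φ : W →+* F}
    (hφ : ∀ x, φ x = 0 → (p : W) ∣ x) {τ : F →*₀ W} (hτ : ∀ x, φ (τ x) = x) :
    Nonempty (CyclotomicTeichmullerRing p F (AdjoinRoot (shiftedCyclotomic p W))) := by
  have hφ_zero : (shiftedCyclotomic p W).eval₂ φ 0 = 0 := by
    rw [eval₂_at_zero, coeff_zero_shiftedCyclotomic, map_natCast, CharP.cast_eq_zero]
  exact ⟨{
    res := AdjoinRoot.lift φ 0 hφ_zero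
    tau := (AdjoinRoot.of (shiftedCyclotomic p W)).toMonoidWithZeroHom.comp τ
    omega := AdjoinRoot.root _ + 1
    res_tau x := (AdjoinRoot.lift_of _).trans (hτ x)
    isPrimitiveRoot_omega := isPrimitiveRoot_root_shiftedCyclotomic_add_one hpW
    sub_one_dvd_of_res_eq_zero x hx := by
      obtain ⟨f, rfl⟩ := AdjoinRoot.mk_surjective x
      rw [AdjoinRoot.lift_mk, eval₂_at_zero] at hx
      rw [add_sub_cancel_right]
      exact root_shiftedCyclotomic_dvd_mk (hφ _ hx) }⟩

end AdjoinRoot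

theorem exists_cyclotomicTeichmullerRing (p : ℕ) [Fact p.Prime] (F : Type u) [Field F] [CharP F p]
    [PerfectRing F p] :
    ∃ (R : Type u) (_ : CommRing R) (_ : IsDomain R) (_ : CharZero R),
      Nonempty (CyclotomicTeichmullerRing p F R) := by
  have hpW : Prime (p : WittVector p F) := (WittVector.irreducible (p := p) (k := F)).prime
  have := charZero_of_natCast_ne_zero (WittVector.constantCoeff (p := p) (R := F)) hpW.ne_zero
  have := isDomain_adjoinRoot_shiftedCyclotomic hpW
  refine ⟨AdjoinRoot (shiftedCyclotomic p (WittVector p F)), inferInstance, inferInstance,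
    charZero_of_injective_ringHom injective_of_shiftedCyclotomic,
    nonempty_cyclotomicTeichmullerRing hpW.ne_zero (φ := WittVector.constantCoeff) (fun x hx => ?_)
      (τ := ⟨⟨WittVector.teichmuller p, WittVector.teichmuller_zero p⟩, map_one _, map_mul _⟩)
      (WittVector.teichmuller_coeff_zero p)⟩
  rwa [← Ideal.mem_span_singleton, ← WittVector.ker_constantCoeff]

end Existence

/-! ### The Stickelberger bound -/

theorem natCast_pow_eq_one_of_pow_eq_succ {b m n : ℕ} (hn : b ^ m = n + 1) :
    (b : ZMod n) ^ m = 1 := by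
  rw [← Nat.cast_pow, hn, Nat.cast_add, ZMod.natCast_self, zero_add, Nat.cast_one]

namespace CyclotomicTeichmullerRing

variable {p : ℕ} {F R : Type*} [Field F] [CommRing R] (T : CyclotomicTeichmullerRing p F R)

section Characters

theorem tau_injective : Function.Injective T.tau :=
  Function.LeftInverse.injective T.res_tau

/-- The multiplicative character of `F` given by the multiplicative representatives. -/
def chi : MulChar F R where
  toMonoidHom := T.tau
  map_nonunit' x hx := by
    rw [isUnit_iff_ne_zero, not_not] at hx
    exact hx ▸ map_zero T.tau

theorem chi_apply (x : F) : T.chi x = T.tau x := rfl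

variable [Fact p.Prime]

theorem sub_one_pow_dvd_prime [IsDomain R] : (T.omega - 1) ^ (p - 1) ∣ (p : R) := by
  obtain ⟨z, -, hz⟩ := T.isPrimitiveRoot_omega.self_sub_one_pow_dvd_order
    (Nat.sub_one_lt_of_lt (Fact.out : p.Prime).pos)
  exact Dvd.intro_left z hz.symm

theorem sub_one_pow_mul_dvd_card [IsDomain R] [Fintype F] {m : ℕ}
    (hq : Fintype.card F = p ^ m) : (T.omega - 1) ^ ((p - 1) * m) ∣ (Fintype.card F : R) := by
  rw [hq, Nat.cast_pow, pow_mul]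
  exact pow_dvd_pow_of_dvd T.sub_one_pow_dvd_prime m

variable [CharP F p]

theorem res_omega : T.res T.omega = 1 := by
  refine frobenius_inj F p ?_
  rw [frobenius_def, frobenius_def, ← map_pow, T.isPrimitiveRoot_omega.pow_eq_one, map_one, one_pow]

theorem dvd_iff (x : R) : T.omega - 1 ∣ x ↔ T.res x = 0 := by
  refine ⟨?_, T.sub_one_dvd_of_res_eq_zero x⟩
  rintro ⟨y, rfl⟩
  rw [map_mul, map_sub, res_omega, map_one, sub_self, zero_mul]

theorem prime_omega_sub_one : Prime (T.omega - 1) := by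
  refine ⟨sub_ne_zero.2 (T.isPrimitiveRoot_omega.ne_one (Fact.out : p.Prime).one_lt),
    fun h => ?_, fun a b h => ?_⟩
  · exact one_ne_zero (T.res.map_one.symm.trans ((T.dvd_iff 1).1 h.dvd))
  · rwa [dvd_iff, map_mul, mul_eq_zero, ← dvd_iff, ← dvd_iff] at h

/-- The additive character `x ↦ ω ^ Tr x` of `F`. -/
noncomputable def psi : AddChar F R :=
  (AddChar.zmodChar p T.isPrimitiveRoot_omega.pow_eq_one).compAddMonoidHom (absTrace p F)

theorem psi_apply (x : F) : T.psi x = T.omega ^ (absTrace p F x).val := rfl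

theorem psi_eq_one_add (x : F) : T.psi x =
    1 + (T.omega - 1) * ∑ i ∈ Finset.range (absTrace p F x).val, T.omega ^ i := by
  rw [mul_geom_sum, psi_apply, add_sub_cancel]

theorem psi_eq_one_iff (x : F) : T.psi x = 1 ↔ absTrace p F x = 0 := by
  rw [psi_apply, T.isPrimitiveRoot_omega.pow_eq_one_iff_dvd, ← ZMod.natCast_eq_zero_iff,
    ZMod.natCast_zmod_val]

variable [Finite F]

theorem psi_pow_pow (k : ℕ) (x : F) : T.psi (x ^ p ^ k) = T.psi x := by
  rw [psi_apply, psi_apply, absTrace_pow_pow]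

theorem psi_ne_one : T.psi ≠ 1 := fun h => by
  have := Fintype.ofFinite F
  have htrace (x : F) : absTrace p F x = 0 := (T.psi_eq_one_iff x).1 (by rw [h, AddChar.one_apply])
  have hsum := sum_inv_mul_absTrace p F
  simp [htrace] at hsum

theorem psi_isPrimitive : T.psi.IsPrimitive :=
  AddChar.IsPrimitive.of_ne_one T.psi_ne_one

end Characters

section GaussSums

variable [Fintype F]

theorem chi_pow_eq_one_iff (a : ℕ) : T.chi ^ a = 1 ↔ Fintype.card F - 1 ∣ a := by
  rw [← FiniteField.forall_pow_eq_one_iff, MulChar.ext_iff]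
  refine forall_congr' fun x => ?_
  rw [MulChar.pow_apply_coe, MulChar.one_apply_coe, chi_apply, ← map_pow,
    ← T.tau.map_one, T.tau_injective.eq_iff, Units.ext_iff, Units.val_pow_eq_pow_val, Units.val_one]

theorem chi_inv_pow_eq_one_iff (a : ℕ) : T.chi⁻¹ ^ a = 1 ↔ Fintype.card F - 1 ∣ a := by
  rw [inv_pow, inv_eq_one, chi_pow_eq_one_iff]

variable [Fact p.Prime] [CharP F p]

/-- The Gauss sum of the `a`-th power of the inverse of `chi`. -/
noncomputable def gauss (a : ℕ) : R := gaussSum (T.chi⁻¹ ^ a) T.psi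

theorem gauss_mul (a : ℕ) : T.gauss (p * a) = T.gauss a := by
  refine Fintype.sum_bijective (frobenius F p) (bijective_frobenius F p) _ _ fun x => ?_
  have hpsi := T.psi_pow_pow 1 x
  rw [pow_one] at hpsi
  rw [frobenius_def, hpsi, map_pow, mul_comm p a, pow_mul,
    MulChar.pow_apply' _ (Fact.out : p.Prime).ne_zero]

variable [IsDomain R]

theorem gauss_zero : T.gauss 0 = -1 := by
  rw [gauss, pow_zero, gaussSum_one_left T.psi_ne_one]

theorem exists_gauss_one (hF : 2 < Fintype.card F) :
    ∃ u, ¬ (T.omega - 1 ∣ u) ∧ T.gauss 1 = (T.omega - 1) * u := by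
  refine ⟨∑ x : F, T.chi⁻¹ x * ∑ i ∈ Finset.range (absTrace p F x).val, T.omega ^ i, ?_, ?_⟩
  · rw [dvd_iff]
    simp only [map_sum, map_mul, map_pow, res_omega, one_pow, Finset.sum_const,
      Finset.card_range, MulChar.inv_apply', chi_apply, T.res_tau, nsmul_eq_mul, mul_one]
    rw [sum_inv_mul_absTrace]
    exact neg_ne_zero.2 one_ne_zero
  · have hchi : T.chi⁻¹ ≠ 1 := fun h =>
      absurd (Nat.dvd_one.1 ((T.chi_inv_pow_eq_one_iff 1).1 (by rw [h, one_pow]))) (by lia)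
    have hsum := MulChar.sum_eq_zero_of_ne_one hchi
    simp only [gauss, gaussSum, psi_eq_one_add, pow_one, mul_add, mul_one, Finset.sum_add_distrib,
      hsum, zero_add, Finset.mul_sum, mul_left_comm (T.omega - 1)]

theorem gauss_add_dvd {a b : ℕ} (h : ¬ Fintype.card F - 1 ∣ a + b) :
    T.gauss (a + b) ∣ T.gauss a * T.gauss b := by
  rw [gauss, gauss, gauss, ← jacobiSum_mul_nontrivial, pow_add]
  · exact Dvd.intro _ rfl
  · rwa [← pow_add, Ne, chi_inv_pow_eq_one_iff]

theorem gauss_add_dvd_gauss_one_pow {a s d : ℕ} (h : T.gauss a ∣ T.gauss 1 ^ s)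
    (hd : a + d < Fintype.card F - 1) : T.gauss (a + d) ∣ T.gauss 1 ^ (s + d) := by
  induction d with
  | zero => exact h
  | succ d ih =>
    refine (T.gauss_add_dvd (a := a + d) (b := 1) fun hdvd => ?_).trans ?_
    · exact (Nat.le_of_dvd (by lia) hdvd).not_gt hd
    · rw [← add_assoc, pow_succ]
      exact mul_dvd_mul_right (ih (by lia)) _

end GaussSums

section Stickelberger

variable [Fintype F] [hp : Fact p.Prime] [CharP F p] [IsDomain R] {m n : ℕ} [NeZero n]

theorem gauss_dvd_gauss_one_pow_digitSum (hq : Fintype.card F = p ^ m)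
    (hn : Fintype.card F = n + 1) (y : ZMod n) :
    T.gauss y.val ∣ T.gauss 1 ^ digitSum p m y := by
  have hle (t : ℕ) (ht : t ≤ m) : p ^ t * y.val / n ≤ y.val := by
    refine Nat.lt_succ_iff.1 (Nat.div_lt_of_lt_mul ?_)
    calc p ^ t * y.val ≤ (n + 1) * y.val :=
          Nat.mul_le_mul_right _ (hn ▸ hq ▸ Nat.pow_le_pow_right hp.out.pos ht)
      _ < n * (y.val + 1) := by linarith [y.val_lt]
  have hprefix (t : ℕ) (ht : t ≤ m) :
      T.gauss (p ^ t * y.val / n) ∣ T.gauss 1 ^ digitSum p t y := by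
    induction t with
    | zero => simp [digitSum, Nat.div_eq_of_lt y.val_lt, T.gauss_zero]
    | succ t ih =>
      have hsucc := hle _ ht
      rw [pow_succ_mul_val_div] at hsucc ⊢
      rw [digitSum, Finset.sum_range_succ]
      refine T.gauss_add_dvd_gauss_one_pow ?_ (by have := y.val_lt; lia)
      rw [T.gauss_mul]
      exact ih (by lia)
  have hval : p ^ m * y.val / n = y.val := by
    rw [← hq, hn, add_mul, one_mul, Nat.mul_add_div (NeZero.pos n), Nat.div_eq_of_lt y.val_lt,
      add_zero]
  exact hval ▸ hprefix m le_rfl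

theorem card_dvd_gauss_mul_gauss (hn : Fintype.card F = n + 1) {y : ZMod n} (hy : y ≠ 0) :
    (Fintype.card F : R) ∣ T.gauss (-y).val * T.gauss y.val := by
  have : NeZero y := ⟨hy⟩
  have hcard : Fintype.card F - 1 = n := by lia
  have hne : T.chi⁻¹ ^ y.val ≠ 1 := by
    rw [Ne, chi_inv_pow_eq_one_iff, hcard]
    exact Nat.not_dvd_of_pos_of_lt (ZMod.val_pos.2 hy) y.val_lt
  have hinv : T.chi⁻¹ ^ (-y).val = (T.chi⁻¹ ^ y.val)⁻¹ := by
    rw [eq_inv_iff_mul_eq_one, ← pow_add, ZMod.val_neg_of_ne_zero,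
      Nat.sub_add_cancel y.val_lt.le, chi_inv_pow_eq_one_iff, hcard]
  rw [gauss, gauss, hinv, ← mul_gaussSum_inv_eq_gaussSum (T.chi⁻¹ ^ y.val)⁻¹, mul_assoc,
    mul_comm (gaussSum _ T.psi⁻¹), gaussSum_mul_gaussSum_eq_card hne T.psi_isPrimitive]
  exact dvd_mul_left _ _

/-- The lower bound in Stickelberger's theorem. -/
theorem pow_digitSum_dvd_gauss (hq : Fintype.card F = p ^ m) (hn : Fintype.card F = n + 1)
    (y : ZMod n) : (T.omega - 1) ^ digitSum p m y ∣ T.gauss y.val := by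
  rcases eq_or_ne y 0 with rfl | hy
  · rw [digitSum_zero, pow_zero]
    exact one_dvd _
  have hm : m ≠ 0 := by
    rintro rfl
    exact Fintype.one_lt_card.ne' hq
  have hp_unit : IsUnit (p : ZMod n) :=
    .of_pow_eq_one (natCast_pow_eq_one_of_pow_eq_succ (hq.symm.trans hn)) hm
  obtain ⟨u, hu, hgauss⟩ := T.exists_gauss_one <| by
    have := y.val_lt
    have := ZMod.val_pos.2 hy
    lia
  have hdvd : (T.omega - 1) ^ ((p - 1) * m) ∣ T.gauss 1 ^ digitSum p m (-y) * T.gauss y.val :=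
    ((T.sub_one_pow_mul_dvd_card hq).trans (T.card_dvd_gauss_mul_gauss hn hy)).trans
      (mul_dvd_mul_right (T.gauss_dvd_gauss_one_pow_digitSum hq hn (-y)) _)
  rw [hgauss, mul_pow, mul_assoc, ← digitSum_add_digitSum_neg hp_unit hy, add_comm, pow_add] at hdvd
  have hprime := T.prime_omega_sub_one
  exact hprime.pow_dvd_of_dvd_mul_left _ (fun h => hu (hprime.dvd_of_dvd_pow h))
    ((mul_dvd_mul_iff_left (pow_ne_zero _ hprime.ne_zero)).1 hdvd)

end Stickelberger

end CyclotomicTeichmullerRing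

/-! ### Gauss sum expansions -/

namespace CyclotomicTeichmullerRing

variable {p : ℕ} {F R : Type*} [Field F] [Fintype F] [CommRing R] [IsDomain R]
  (T : CyclotomicTeichmullerRing p F R)

section GaussExpansion

theorem sum_tau_pow {a : ℕ} (ha : ¬ Fintype.card F - 1 ∣ a) : ∑ y, T.tau y ^ a = 0 := by
  rw [← MulChar.sum_eq_zero_of_ne_one (mt (T.chi_pow_eq_one_iff a).1 ha)]
  refine Finset.sum_congr rfl fun y _ => ?_
  rw [MulChar.pow_apply' _ (by rintro rfl; exact ha (dvd_zero _)), chi_apply]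

theorem geom_sum_tau_of_ne_one {x : F} (hx : x ≠ 0) (hx1 : x ≠ 1) :
    ∑ k ∈ Finset.range (Fintype.card F - 1), T.tau x ^ k = 0 := by
  have hgeom := mul_geom_sum (T.tau x) (Fintype.card F - 1)
  rw [← map_pow, FiniteField.pow_card_sub_one_eq_one x hx, map_one, sub_self] at hgeom
  refine (mul_eq_zero.1 hgeom).resolve_left (sub_ne_zero.2 ?_)
  exact map_one T.tau ▸ T.tau_injective.ne hx1

theorem sum_chi_inv_pow_mul_tau_pow [DecidableEq F] {u : F} (hu : u ≠ 0) (x : F) :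
    ∑ k ∈ Finset.range (Fintype.card F - 1), (T.chi⁻¹ ^ k) x * T.tau u ^ k
      = if x = u then ((Fintype.card F - 1 : ℕ) : R) else 0 := by
  rcases eq_or_ne x 0 with rfl | hx
  · simp only [MulChar.map_zero, zero_mul, Finset.sum_const_zero, if_neg hu.symm]
  have hterm (k : ℕ) : (T.chi⁻¹ ^ k) x * T.tau u ^ k = T.tau (x⁻¹ * u) ^ k := by
    have hpow := MulChar.pow_apply_coe T.chi⁻¹ k (Units.mk0 x hx)
    rw [Units.val_mk0, MulChar.inv_apply', chi_apply] at hpow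
    rw [hpow, map_mul, mul_pow]
  simp only [hterm]
  split_ifs with hxu
  · simp [hxu, hu]
  · exact T.geom_sum_tau_of_ne_one (mul_ne_zero (inv_ne_zero hx) hu)
      fun h => hxu ((inv_mul_eq_one₀ hx).1 h)

variable [Fact p.Prime] [CharP F p]

/-- The Fourier expansion of `(q - 1) * psi` on the multiplicative group of the field `F` with
`q` elements; its coefficients are the Gauss sums. -/
noncomputable def gaussExpansion (u : F) : R :=
  ∑ k ∈ Finset.range (Fintype.card F - 1), T.gauss k * T.tau u ^ k

theorem gaussExpansion_zero : T.gaussExpansion 0 = -1 := by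
  have hcard : 0 < Fintype.card F - 1 := Nat.sub_pos_of_lt Fintype.one_lt_card
  rw [gaussExpansion, Finset.sum_eq_single_of_mem 0 (Finset.mem_range.2 hcard)
    fun k _ hk => by rw [map_zero, zero_pow hk, mul_zero], T.gauss_zero, pow_zero, mul_one]

theorem gaussExpansion_of_ne_zero {u : F} (hu : u ≠ 0) :
    T.gaussExpansion u = (Fintype.card F - 1 : ℕ) * T.psi u := by
  classical
  have hterm (k : ℕ) : T.gauss k * T.tau u ^ k
      = ∑ x, ((T.chi⁻¹ ^ k) x * T.tau u ^ k) * T.psi x := by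
    rw [gauss, gaussSum, Finset.sum_mul]
    exact Finset.sum_congr rfl fun x _ => mul_right_comm _ _ _
  simp only [gaussExpansion, hterm]
  rw [Finset.sum_comm]
  simp only [← Finset.sum_mul, T.sum_chi_inv_pow_mul_tau_pow hu, ite_mul, zero_mul,
    Finset.sum_ite_eq', Finset.mem_univ, if_true]

theorem card_dvd_sub_gaussExpansion (u : F) :
    (Fintype.card F : R) ∣ (Fintype.card F - 1 : ℕ) * T.psi u - T.gaussExpansion u := by
  rcases eq_or_ne u 0 with rfl | hu
  · rw [gaussExpansion_zero, AddChar.map_zero_eq_one, Nat.cast_pred Fintype.card_pos, mul_one,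
      sub_neg_eq_add, sub_add_cancel]
  · rw [T.gaussExpansion_of_ne_zero hu, sub_self]
    exact dvd_zero _

omit [IsDomain R] in
theorem sum_tau_pow_mul_gaussExpansion_mul (s d : ℕ) (β γ : F) :
    ∑ y : F, T.tau y ^ s * (T.gaussExpansion (β * y ^ d) * T.gaussExpansion (γ * y)) =
      ∑ i ∈ Finset.range (Fintype.card F - 1), ∑ j ∈ Finset.range (Fintype.card F - 1),
        T.gauss i * T.gauss j *
          (T.tau β ^ i * T.tau γ ^ j * ∑ y, T.tau y ^ (s + d * i + j)) := by
  simp only [gaussExpansion, Finset.sum_mul_sum]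
  simp only [Finset.mul_sum, map_mul, map_pow]
  rw [Finset.sum_comm]
  refine Finset.sum_congr rfl fun i _ => ?_
  rw [Finset.sum_comm]
  refine Finset.sum_congr rfl fun j _ => Finset.sum_congr rfl fun y _ => ?_
  ring

end GaussExpansion

section DigitBound

variable [Fact p.Prime] [CharP F p] {m n s d M : ℕ} [NeZero n]

theorem pow_dvd_sum_tau_pow_mul_gaussExpansion_mul (hq : Fintype.card F = p ^ m)
    (hn : Fintype.card F = n + 1)
    (hM : ∀ i j : ZMod n, s + d * i + j = 0 → M ≤ digitSum p m i + digitSum p m j) (β γ : F) :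
    (T.omega - 1) ^ M ∣
      ∑ y : F, T.tau y ^ s * (T.gaussExpansion (β * y ^ d) * T.gaussExpansion (γ * y)) := by
  have hgauss {i : ℕ} (hi : i ∈ Finset.range n) :
      (T.omega - 1) ^ digitSum p m (i : ZMod n) ∣ T.gauss i := by
    have hdvd := T.pow_digitSum_dvd_gauss hq hn (i : ZMod n)
    rwa [ZMod.val_natCast, Nat.mod_eq_of_lt (Finset.mem_range.1 hi)] at hdvd
  rw [sum_tau_pow_mul_gaussExpansion_mul, hn, Nat.add_sub_cancel]
  refine Finset.dvd_sum fun i hi => Finset.dvd_sum fun j hj => ?_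
  by_cases hdvd : n ∣ s + d * i + j
  · have hij := (ZMod.natCast_eq_zero_iff _ n).2 hdvd
    push_cast at hij
    refine ((pow_dvd_pow _ (hM i j hij)).trans ?_).mul_right _
    rw [pow_add]
    exact mul_dvd_mul (hgauss hi) (hgauss hj)
  · rw [T.sum_tau_pow (by rwa [hn, Nat.add_sub_cancel]), mul_zero, mul_zero]
    exact dvd_zero _

theorem pow_dvd_sum_tau_pow_mul_psi_mul_psi (hq : Fintype.card F = p ^ m)
    (hn : Fintype.card F = n + 1) (hMm : M ≤ (p - 1) * m)
    (hM : ∀ i j : ZMod n, s + d * i + j = 0 → M ≤ digitSum p m i + digitSum p m j) (β γ : F) :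
    (T.omega - 1) ^ M ∣ ∑ y : F, T.tau y ^ s * (T.psi (β * y ^ d) * T.psi (γ * y)) := by
  have hdvd_card : (T.omega - 1) ^ M ∣ (Fintype.card F : R) :=
    (pow_dvd_pow _ hMm).trans (T.sub_one_pow_mul_dvd_card hq)
  have hnot_dvd : ¬ T.omega - 1 ∣ ((Fintype.card F - 1 : ℕ) : R) := by
    rw [dvd_iff, Nat.cast_pred Fintype.card_pos, map_sub, map_natCast, map_one,
      FiniteField.cast_card_eq_zero, zero_sub]
    exact neg_ne_zero.2 one_ne_zero
  have hdvd : (T.omega - 1) ^ M ∣ ((Fintype.card F - 1 : ℕ) : R) * ((Fintype.card F - 1 : ℕ) *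
      ∑ y : F, T.tau y ^ s * (T.psi (β * y ^ d) * T.psi (γ * y))) := by
    rw [← dvd_sub_left (T.pow_dvd_sum_tau_pow_mul_gaussExpansion_mul hq hn hM β γ),
      Finset.mul_sum, Finset.mul_sum, ← Finset.sum_sub_distrib]
    refine hdvd_card.trans (Finset.dvd_sum fun y _ => ?_)
    have hterm := dvd_mul_sub_mul (T.card_dvd_sub_gaussExpansion (β * y ^ d))
      (T.card_dvd_sub_gaussExpansion (γ * y))
    refine (hterm.mul_left (T.tau y ^ s)).trans (dvd_of_eq ?_)
    ring
  have hprime := T.prime_omega_sub_one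
  exact hprime.pow_dvd_of_dvd_mul_left _ hnot_dvd
    (hprime.pow_dvd_of_dvd_mul_left _ hnot_dvd hdvd)

end DigitBound

end CyclotomicTeichmullerRing

namespace CyclotomicTeichmullerRing

variable {F R : Type*} [Field F] [Fintype F] [CharP F 3] [CommRing R] [IsDomain R]
  (T : CyclotomicTeichmullerRing 3 F R) {h : ℕ}

theorem pow_dvd_welch_sum (hq : Fintype.card F = 3 ^ (2 * h + 1)) (β γ : F) :
    (T.omega - 1) ^ (2 * h + 1) ∣ ∑ y : F, T.tau y ^ ((Fintype.card F - 1) / 2) *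
      (T.psi (β * y ^ (3 ^ (h + 1) + 2)) * T.psi (γ * y)) := by
  obtain ⟨n, hn⟩ : ∃ n, Fintype.card F = n + 1 := ⟨_, (Nat.sub_add_cancel Fintype.card_pos).symm⟩
  have : NeZero n := ⟨by rintro rfl; exact Fintype.one_lt_card.ne' hn⟩
  have hn_even : Even n := by
    have hodd : Odd (n + 1) := hn ▸ hq ▸ Odd.pow (by decide)
    simpa [parity_simps] using hodd
  have hthree : (3 : ZMod n) ^ (2 * h + 1) = 1 :=
    natCast_pow_eq_one_of_pow_eq_succ (hq.symm.trans hn)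
  have hsq : (3 : ZMod n) ^ (h + 1) * 3 ^ (h + 1) = 3 := by
    rw [← pow_add, show h + 1 + (h + 1) = 2 * h + 1 + 1 by ring, pow_succ, hthree, one_mul]
  refine T.pow_dvd_sum_tau_pow_mul_psi_mul_psi hq hn (by lia) (fun i j hij => ?_) β γ
  rw [hn, Nat.add_sub_cancel] at hij
  push_cast at hij
  exact le_digitSum_add_digitSum hn_even hthree hsq
    (by linear_combination hij - two_mul_half hn_even)

theorem pow_dvd_reeTits_sum (hq : Fintype.card F = 3 ^ (2 * h + 1)) (a b : F) :
    (T.omega - 1) ^ (2 * h + 1) ∣ ∑ y : F, T.tau y ^ ((Fintype.card F - 1) / 2) *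
      T.psi (b * reeTitsMap (3 ^ (h + 1)) a y) := by
  obtain ⟨e, rfl⟩ := (bijective_iterateFrobenius F 3 (h + 1)).surjective b
  have hσσ := iterateFrobenius_iterateFrobenius_of_card (Nat.card_eq_fintype_card.trans hq)
  have hpsi (x : F) : T.psi (iterateFrobenius F 3 (h + 1) x) = T.psi x := by
    rw [iterateFrobenius_def, T.psi_pow_pow]
  set σ := iterateFrobenius F 3 (h + 1) with hσ
  refine (T.pow_dvd_welch_sum hq e (e * a - σ e * a ^ 2)).trans
    (dvd_of_eq (Finset.sum_congr rfl fun y _ => ?_))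
  have hsplit : σ e * reeTitsMap (3 ^ (h + 1)) a y =
      σ (e * y ^ (3 ^ (h + 1) + 2)) + (σ (e * a * y) + -(σ e * a ^ 2 * y)) := by
    rw [reeTitsMap_three_pow, pow_add, ← iterateFrobenius_def 3 (h + 1) y, ← hσ]
    simp only [map_mul, map_pow, hσσ]
    ring
  rw [hsplit, AddChar.map_add_eq_mul, AddChar.map_add_eq_mul, hpsi, hpsi,
    ← AddChar.map_add_eq_mul T.psi (e * a * y), sub_mul, sub_eq_add_neg]

end CyclotomicTeichmullerRing

/-! ### Skew sets -/

/-- A finite set which contains exactly one of `u` and `-u` for every nonzero `u`, and which does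
not contain `0`. -/
def IsSkew {G : Type*} [AddGroup G] (D : Finset G) : Prop := ∀ u, u ∈ D ↔ u ≠ 0 ∧ -u ∉ D

namespace IsSkew

variable {G : Type*}

theorem zero_notMem [AddGroup G] {D : Finset G} (hD : IsSkew D) : 0 ∉ D := fun h0 =>
  ((hD 0).1 h0).1 rfl

theorem compl_eq [AddGroup G] [Fintype G] [DecidableEq G] {D : Finset G} (hD : IsSkew D) :
    Dᶜ = insert 0 (-D) := by
  ext u
  rw [Finset.mem_compl, hD u, Finset.mem_insert, Finset.mem_neg']
  tauto

theorem sum_eq {M : Type*} [AddGroup G] [Fintype G] [AddCommMonoid M] {D : Finset G}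
    (hD : IsSkew D) (f : G → M) : ∑ u, f u = f 0 + ∑ u ∈ D, (f u + f (-u)) := by
  classical
  have hzero : 0 ∉ -D := by rw [Finset.mem_neg', neg_zero]; exact hD.zero_notMem
  rw [← Finset.sum_add_sum_compl D, hD.compl_eq, Finset.sum_insert hzero, Finset.sum_neg_index,
    Finset.sum_add_distrib, add_left_comm]

theorem card_eq [AddGroup G] [Fintype G] {D : Finset G} (hD : IsSkew D) :
    Fintype.card G = 2 * D.card + 1 := by
  have hsum := hD.sum_eq fun _ => 1
  simp only [Finset.sum_const, Finset.card_univ, smul_eq_mul] at hsum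
  lia

theorem image {H : Type*} [AddGroup G] [AddGroup H] [DecidableEq H] {D : Finset G}
    (hD : IsSkew D) {f : G → H} (hf : Function.Bijective f) (hf0 : f 0 = 0)
    (hneg : ∀ x, f (-x) = -f x) : IsSkew (D.image f) := by
  intro u
  obtain ⟨x, rfl⟩ := hf.surjective u
  rw [← hneg, hf.injective.mem_finset_image, hf.injective.mem_finset_image, ← hf0,
    hf.injective.ne_iff]
  exact hD x

end IsSkew

section NonzeroSquares

variable {F : Type*} [Field F] [Fintype F]

open Classical in
/-- The set of nonzero squares of a finite field. -/
noncomputable def nonzeroSquares (F : Type*) [Field F] [Fintype F] : Finset F :=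
  {x | x ≠ 0 ∧ IsSquare x}

theorem mem_nonzeroSquares {x : F} : x ∈ nonzeroSquares F ↔ x ≠ 0 ∧ IsSquare x := by
  simp only [nonzeroSquares, Finset.mem_filter, Finset.mem_univ, true_and]

theorem isSquare_neg_iff_not_isSquare (hF : Fintype.card F % 4 = 3) {x : F} (hx : x ≠ 0) :
    IsSquare (-x) ↔ ¬ IsSquare x := by
  classical
  have hone : quadraticChar F (-1) = -1 := by
    rw [quadraticChar_neg_one_iff_not_isSquare, FiniteField.isSquare_neg_one_iff, hF]
    exact not_not.2 rfl
  rw [← quadraticChar_neg_one_iff_not_isSquare,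
    ← quadraticChar_one_iff_isSquare (neg_ne_zero.2 hx), neg_eq_neg_one_mul x, map_mul, hone,
    neg_one_mul, neg_eq_iff_eq_neg]

theorem isSkew_nonzeroSquares (hF : Fintype.card F % 4 = 3) : IsSkew (nonzeroSquares F) := by
  intro x
  rw [mem_nonzeroSquares, mem_nonzeroSquares, and_congr_right_iff]
  intro hx
  rw [isSquare_neg_iff_not_isSquare hF hx, neg_ne_zero, and_iff_right hx, not_not]

theorem coe_image_reeTitsMap_nonzeroSquares [DecidableEq F] (α : ℕ) (a : F) :
    ((nonzeroSquares F).image (reeTitsMap α a) : Set F) = reeTitsSet α a := by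
  ext y
  simp only [Finset.coe_image, Set.mem_image, Finset.mem_coe, mem_nonzeroSquares, reeTitsSet]
  constructor
  · rintro ⟨_, ⟨hx, x, rfl⟩, rfl⟩
    exact ⟨x, left_ne_zero_of_mul hx, by rw [sq]⟩
  · rintro ⟨x, hx, rfl⟩
    exact ⟨x ^ 2, ⟨pow_ne_zero 2 hx, x, sq x⟩, rfl⟩

end NonzeroSquares

namespace CyclotomicTeichmullerRing

theorem tau_neg_one {p : ℕ} {F R : Type*} [Field F] [CommRing R] [IsDomain R]
    (T : CyclotomicTeichmullerRing p F R) (hF : (-1 : F) ≠ 1) : T.tau (-1) = -1 := by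
  refine (sq_eq_one_iff.1 (by rw [← map_pow, neg_one_sq, map_one])).resolve_left fun h => hF ?_
  exact T.tau_injective (h.trans T.tau.map_one.symm)

section CharacterSums

variable {p : ℕ} {F R : Type*} [Field F] [CommRing R] (T : CyclotomicTeichmullerRing p F R)
  [Fact p.Prime] [CharP F p] {D : Finset F}

/-- The sum over `D` of the additive character `x ↦ psi (b * x)`. -/
noncomputable def charSum (D : Finset F) (b : F) : R := ∑ d ∈ D, T.psi (b * d)

theorem charSum_zero : T.charSum D 0 = D.card := by
  simp [charSum]

theorem charSum_neg (b : F) : T.charSum D (-b) = ∑ d ∈ D, T.psi (-(b * d)) :=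
  Finset.sum_congr rfl fun d _ => by rw [neg_mul]

variable [Fintype F] [IsDomain R]

theorem charSum_image_nonzeroSquares_sub [DecidableEq F] (hF : Fintype.card F % 4 = 3)
    {f : F → F} (hf : Function.Injective f) (hneg : ∀ x, f (-x) = -f x) (b : F) :
    T.charSum ((nonzeroSquares F).image f) b - T.charSum ((nonzeroSquares F).image f) (-b) =
      ∑ y, T.tau y ^ ((Fintype.card F - 1) / 2) * T.psi (b * f y) := by
  have hhalf : Odd ((Fintype.card F - 1) / 2) := Nat.odd_iff.2 (by lia)
  have htwo : Fintype.card F - 1 = 2 * ((Fintype.card F - 1) / 2) := by lia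
  have hneg_one : (-1 : F) ≠ 1 := fun h =>
    FiniteField.isSquare_neg_one_iff.1 (h.symm ▸ IsSquare.one) hF
  rw [(isSkew_nonzeroSquares hF).sum_eq, map_zero, zero_pow hhalf.pos.ne', zero_mul, zero_add,
    charSum_neg, charSum, Finset.sum_image hf.injOn, Finset.sum_image hf.injOn,
    ← Finset.sum_sub_distrib]
  refine Finset.sum_congr rfl fun y hy => ?_
  obtain ⟨hy0, x, rfl⟩ := mem_nonzeroSquares.1 hy
  have htau : T.tau (x * x) ^ ((Fintype.card F - 1) / 2) = 1 := by
    rw [← map_pow, ← sq, ← pow_mul, ← htwo,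
      FiniteField.pow_card_sub_one_eq_one x (left_ne_zero_of_mul hy0), map_one]
  have htau_neg : T.tau (-(x * x)) ^ ((Fintype.card F - 1) / 2) = -1 := by
    rw [neg_eq_neg_one_mul, map_mul, mul_pow, htau, T.tau_neg_one hneg_one, hhalf.neg_one_pow,
      mul_one]
  rw [htau, htau_neg, hneg, mul_neg, one_mul, neg_one_mul, sub_eq_add_neg]

theorem sum_psi_mul [DecidableEq F] (u : F) :
    ∑ b, T.psi (b * u) = if u = 0 then (Fintype.card F : R) else 0 := by
  rw [AddChar.sum_mulShift u T.psi_isPrimitive]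
  split_ifs <;> simp

omit [Fintype F] in
theorem charSum_add_charSum_neg [Finite F] (hD : IsSkew D) {b : F} (hb : b ≠ 0) :
    T.charSum D b + T.charSum D (-b) = -1 := by
  classical
  have := Fintype.ofFinite F
  have hsum := T.sum_psi_mul b
  rw [if_neg hb, hD.sum_eq] at hsum
  rw [charSum_neg, charSum, ← Finset.sum_add_distrib]
  simp only [mul_comm _ b, mul_zero, AddChar.map_zero_eq_one, mul_neg] at hsum
  linear_combination hsum

theorem sum_charSum_mul_charSum_neg_mul_psi [DecidableEq F] (g : F) :
    ∑ b, T.charSum D b * T.charSum D (-b) * T.psi (-(b * g)) =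
      Fintype.card F * ((D ×ˢ D).filter fun d => d.1 - d.2 = g).card := by
  have hterm (b : F) : T.charSum D b * T.charSum D (-b) * T.psi (-(b * g)) =
      ∑ d ∈ D ×ˢ D, T.psi (b * (d.1 - d.2 - g)) := by
    rw [charSum_neg, charSum, Finset.sum_mul_sum, ← Finset.sum_product', Finset.sum_mul]
    refine Finset.sum_congr rfl fun d _ => ?_
    rw [← AddChar.map_add_eq_mul, ← AddChar.map_add_eq_mul]
    congr 1
    ring
  simp only [hterm]
  rw [Finset.sum_comm]
  simp only [T.sum_psi_mul, sub_eq_zero]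
  rw [← Finset.sum_filter, Finset.sum_const, nsmul_eq_mul, mul_comm]

theorem sum_charSum_mul_charSum_neg :
    ∑ b, T.charSum D b * T.charSum D (-b) = Fintype.card F * D.card := by
  classical
  have hdiag : (D ×ˢ D).filter (fun d => d.1 - d.2 = 0) = D.diag := by
    ext ⟨x, y⟩
    simp only [Finset.mem_filter, Finset.mem_product, Finset.mem_diag, sub_eq_zero]
    constructor
    · rintro ⟨⟨hx, -⟩, hxy⟩
      exact ⟨hx, hxy⟩
    · rintro ⟨hx, rfl⟩
      exact ⟨⟨hx, hx⟩, rfl⟩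
  have hsum := T.sum_charSum_mul_charSum_neg_mul_psi (D := D) 0
  rw [hdiag, Finset.diag_card] at hsum
  simpa only [mul_zero, neg_zero, AddChar.map_zero_eq_one, mul_one] using hsum

theorem four_mul_card_filter_sub_eq_add_three [DecidableEq F] [CharZero R] (hD : IsSkew D)
    (hnorm : ∀ b ≠ 0, 4 * (T.charSum D b * T.charSum D (-b)) = 1 + Fintype.card F)
    {g : F} (hg : g ≠ 0) :
    4 * ((D ×ˢ D).filter fun d => d.1 - d.2 = g).card + 3 = Fintype.card F := by
  have hcount := T.sum_charSum_mul_charSum_neg_mul_psi (D := D) g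
  rw [← Finset.add_sum_erase _ _ (Finset.mem_univ (0 : F))] at hcount
  simp only [neg_zero, zero_mul, AddChar.map_zero_eq_one, mul_one, charSum_zero] at hcount
  have hpsi := T.sum_psi_mul (-g)
  rw [if_neg (neg_ne_zero.2 hg), ← Finset.add_sum_erase _ _ (Finset.mem_univ (0 : F)), zero_mul,
    AddChar.map_zero_eq_one] at hpsi
  have hnorm_sum : ∑ b ∈ Finset.univ.erase (0 : F),
        4 * (T.charSum D b * T.charSum D (-b) * T.psi (-(b * g))) =
      ∑ b ∈ Finset.univ.erase (0 : F), (1 + Fintype.card F) * T.psi (b * -g) :=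
    Finset.sum_congr rfl fun b hb => by
      rw [← mul_assoc, hnorm b (Finset.ne_of_mem_erase hb), mul_neg]
  rw [← Finset.mul_sum, ← Finset.mul_sum] at hnorm_sum
  have hcard : (Fintype.card F : R) = 2 * D.card + 1 := by exact_mod_cast hD.card_eq
  have hmul : (Fintype.card F : R) * (4 * ((D ×ˢ D).filter fun d => d.1 - d.2 = g).card + 3) =
      Fintype.card F * Fintype.card F := by
    linear_combination -4 * hcount + hnorm_sum + (1 + (Fintype.card F : R)) * hpsi
      + (-2 * (D.card : R) - Fintype.card F + 1) * hcard
  exact_mod_cast mul_left_cancel₀ (Nat.cast_ne_zero.2 Fintype.card_ne_zero) hmul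

end CharacterSums


section Ternary

variable {F R : Type*} [Field F] [CommRing R] [IsDomain R]
  (T : CyclotomicTeichmullerRing 3 F R)

theorem one_add_omega_add_omega_sq : 1 + T.omega + T.omega ^ 2 = 0 := by
  have hgeom := T.isPrimitiveRoot_omega.geom_sum_eq_zero (by decide)
  rwa [Finset.sum_range_succ, Finset.sum_range_succ, Finset.sum_range_one, pow_zero,
    pow_one] at hgeom

omit [IsDomain R] in
theorem omega_pow_sub_omega_pow_neg (t : ZMod 3) :
    T.omega ^ t.val - T.omega ^ (-t).val = (t.valMinAbs : R) * (T.omega - T.omega ^ 2) := by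
  fin_cases t
  · change T.omega ^ 0 - T.omega ^ 0 = ((0 : ℤ) : R) * (T.omega - T.omega ^ 2)
    push_cast; ring
  · change T.omega ^ 1 - T.omega ^ 2 = ((1 : ℤ) : R) * (T.omega - T.omega ^ 2)
    push_cast; ring
  · change T.omega ^ 2 - T.omega ^ 1 = ((-1 : ℤ) : R) * (T.omega - T.omega ^ 2)
    push_cast; ring

theorem omega_pow_add_omega_pow_neg (t : ZMod 3) :
    T.omega ^ t.val + T.omega ^ (-t).val = 2 - 3 * (t.valMinAbs : R) ^ 2 := by
  fin_cases t
  · change T.omega ^ 0 + T.omega ^ 0 = 2 - 3 * ((0 : ℤ) : R) ^ 2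
    push_cast; ring
  · change T.omega ^ 1 + T.omega ^ 2 = 2 - 3 * ((1 : ℤ) : R) ^ 2
    push_cast; linear_combination T.one_add_omega_add_omega_sq
  · change T.omega ^ 2 + T.omega ^ 1 = 2 - 3 * ((-1 : ℤ) : R) ^ 2
    push_cast; linear_combination T.one_add_omega_add_omega_sq

variable [CharP F 3]

theorem three_pow_dvd_of_omega_sub_one_pow_dvd {k : ℕ} {N : ℤ}
    (h : (T.omega - 1) ^ (2 * k) ∣ (N : R)) : 3 ^ k ∣ N := by
  induction k generalizing N with
  | zero => exact one_dvd N
  | succ k ih =>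
    have hdvd : T.omega - 1 ∣ (N : R) := (dvd_pow_self _ (by lia)).trans h
    rw [dvd_iff, map_intCast, CharP.intCast_eq_zero_iff F 3] at hdvd
    obtain ⟨N, rfl⟩ := hdvd
    rw [Nat.cast_ofNat, pow_succ']
    refine mul_dvd_mul_left 3 (ih ?_)
    have hthree : (T.omega - 1) ^ 2 * (N : R) = -T.omega * ((3 * N : ℤ) : R) := by
      push_cast
      linear_combination (N : R) * T.one_add_omega_add_omega_sq
    refine (mul_dvd_mul_iff_left (pow_ne_zero 2 T.prime_omega_sub_one.ne_zero)).1 ?_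
    rw [← pow_add, add_comm, ← mul_add_one, hthree]
    exact h.mul_left _

/-- The sum over `D` of the absolute traces of `b * d`, lifted from `ZMod 3` to `{-1, 0, 1}`. It
is the coefficient of `ω - ω ^ 2` in the difference of the character sums of `D` and `-D`. -/
noncomputable def signedTraceSum (D : Finset F) (b : F) : ℤ :=
  ∑ d ∈ D, (absTrace 3 F (b * d)).valMinAbs

variable {D : Finset F}

omit [IsDomain R] in
theorem charSum_sub_charSum_neg (b : F) : T.charSum D b - T.charSum D (-b) =
    (signedTraceSum D b : R) * (T.omega - T.omega ^ 2) := by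
  rw [charSum_neg, charSum, ← Finset.sum_sub_distrib, signedTraceSum, Int.cast_sum,
    Finset.sum_mul]
  refine Finset.sum_congr rfl fun d _ => ?_
  rw [psi_apply, psi_apply, map_neg, omega_pow_sub_omega_pow_neg]

theorem three_pow_dvd_signedTraceSum {h : ℕ} {b : F}
    (hdvd : (T.omega - 1) ^ (2 * h + 1) ∣ T.charSum D b - T.charSum D (-b)) :
    3 ^ h ∣ signedTraceSum D b := by
  refine T.three_pow_dvd_of_omega_sub_one_pow_dvd ?_
  refine (mul_dvd_mul_iff_right T.prime_omega_sub_one.ne_zero).1 ?_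
  have hmul : (signedTraceSum D b : R) * (T.omega - 1) =
      -T.omega ^ 2 * (T.charSum D b - T.charSum D (-b)) := by
    rw [charSum_sub_charSum_neg]
    linear_combination (-(signedTraceSum D b : R) * (T.omega - 1)) *
      T.isPrimitiveRoot_omega.pow_eq_one
  rw [← pow_succ, hmul]
  exact hdvd.mul_left _

theorem four_mul_charSum_mul_charSum_neg [Finite F] (hD : IsSkew D) {b : F} (hb : b ≠ 0) :
    4 * (T.charSum D b * T.charSum D (-b)) = 1 + 3 * (signedTraceSum D b : R) ^ 2 := by
  have hdisc : (T.omega - T.omega ^ 2) ^ 2 = -3 := by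
    linear_combination (T.omega ^ 2 - 3 * T.omega + 3) * T.one_add_omega_add_omega_sq
  have hadd := congrArg (· ^ 2) (T.charSum_add_charSum_neg hD hb)
  have hsub := congrArg (· ^ 2) (T.charSum_sub_charSum_neg (D := D) b)
  simp only [mul_pow, hdisc] at hadd hsub
  linear_combination hadd - hsub

variable [Fintype F] [CharZero R] {m : ℕ}

include T in
theorem sum_valMinAbs_absTrace_sq (hq : Fintype.card F = 3 ^ (m + 1)) (hD : IsSkew D) {b : F}
    (hb : b ≠ 0) : ∑ d ∈ D, (absTrace 3 F (b * d)).valMinAbs ^ 2 = 3 ^ m := by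
  have hadd := T.charSum_add_charSum_neg hD hb
  rw [charSum_neg, charSum, ← Finset.sum_add_distrib] at hadd
  simp only [psi_apply, map_neg, omega_pow_add_omega_pow_neg, Finset.sum_sub_distrib,
    Finset.sum_const, ← Finset.mul_sum, nsmul_eq_mul] at hadd
  have hadd_int :
      (D.card : ℤ) * 2 - 3 * ∑ d ∈ D, (absTrace 3 F (b * d)).valMinAbs ^ 2 = -1 := by
    exact_mod_cast hadd
  have hcard := hD.card_eq
  rw [hq, pow_succ] at hcard
  zify at hcard
  linarith

include T in
theorem odd_signedTraceSum (hq : Fintype.card F = 3 ^ (m + 1)) (hD : IsSkew D) {b : F}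
    (hb : b ≠ 0) : Odd (signedTraceSum D b) := by
  have hodd : Odd (∑ d ∈ D, (absTrace 3 F (b * d)).valMinAbs ^ 2) := by
    rw [T.sum_valMinAbs_absTrace_sq hq hD hb]
    exact Odd.pow (by decide)
  have heven : Even (∑ d ∈ D, (absTrace 3 F (b * d)).valMinAbs ^ 2 - signedTraceSum D b) := by
    rw [signedTraceSum, ← Finset.sum_sub_distrib]
    refine Finset.even_sum _ fun d _ => ?_
    rw [sq, ← mul_sub_one]
    exact Int.even_mul_pred_self _
  exact sub_sub_cancel _ (signedTraceSum D b) ▸ hodd.sub_even heven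

include T in
theorem sum_signedTraceSum_sq [DecidableEq F] (hq : Fintype.card F = 3 ^ (m + 1))
    (hD : IsSkew D) :
    ∑ b ∈ Finset.univ.erase (0 : F), signedTraceSum D b ^ 2 =
      ∑ _b ∈ Finset.univ.erase (0 : F), (3 : ℤ) ^ m := by
  have hcard := hD.card_eq
  have hcard_erase : (Finset.univ.erase (0 : F)).card = 2 * D.card := by
    rw [Finset.card_erase_of_mem (Finset.mem_univ _), Finset.card_univ, hcard,
      Nat.add_sub_cancel]
  have hparseval := T.sum_charSum_mul_charSum_neg (D := D)
  rw [← Finset.add_sum_erase _ _ (Finset.mem_univ (0 : F)), neg_zero, charSum_zero] at hparseval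
  have hsum := Finset.sum_congr rfl fun b (hb : b ∈ Finset.univ.erase (0 : F)) =>
    T.four_mul_charSum_mul_charSum_neg hD (Finset.ne_of_mem_erase hb)
  rw [← Finset.mul_sum, Finset.sum_add_distrib, ← Finset.mul_sum, Finset.sum_const, hcard_erase,
    nsmul_eq_mul, mul_one] at hsum
  have hsum_sq : 4 * ((Fintype.card F : ℤ) * D.card - D.card * D.card) = (2 * D.card : ℕ) +
      3 * ∑ b ∈ Finset.univ.erase (0 : F), signedTraceSum D b ^ 2 := by
    have hcast : 4 * ((Fintype.card F : R) * D.card - D.card * D.card) = (2 * D.card : ℕ) +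
        3 * ∑ b ∈ Finset.univ.erase (0 : F), (signedTraceSum D b : R) ^ 2 := by
      linear_combination hsum - 4 * hparseval
    exact_mod_cast hcast
  rw [Finset.sum_const, hcard_erase, nsmul_eq_mul]
  rw [hq, pow_succ] at hcard hsum_sq
  push_cast at hsum_sq ⊢
  have hpow : (3 : ℤ) ^ m * 3 = 2 * D.card + 1 := by exact_mod_cast hcard
  refine mul_left_cancel₀ (three_ne_zero (α := ℤ)) ?_
  linear_combination -hsum_sq + 2 * (D.card : ℤ) * hpow

theorem signedTraceSum_sq {h : ℕ} (hq : Fintype.card F = 3 ^ (2 * h + 1)) (hD : IsSkew D)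
    (hdvd : ∀ b, (T.omega - 1) ^ (2 * h + 1) ∣ T.charSum D b - T.charSum D (-b))
    {b : F} (hb : b ≠ 0) : signedTraceSum D b ^ 2 = 3 ^ (2 * h) := by
  classical
  have hle : ∀ b ∈ Finset.univ.erase (0 : F), (3 : ℤ) ^ (2 * h) ≤ signedTraceSum D b ^ 2 := by
    intro b hb
    have hne : signedTraceSum D b ≠ 0 := fun hzero =>
      Int.not_odd_zero (hzero ▸ T.odd_signedTraceSum hq hD (Finset.ne_of_mem_erase hb))
    rw [mul_comm, pow_mul]
    exact Int.le_of_dvd (sq_pos_of_ne_zero hne)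
      (pow_dvd_pow_of_dvd (T.three_pow_dvd_signedTraceSum (hdvd b)) 2)
  exact (((Finset.sum_eq_sum_iff_of_le hle).1 (T.sum_signedTraceSum_sq hq hD).symm) b
    (Finset.mem_erase.2 ⟨hb, Finset.mem_univ _⟩)).symm

end Ternary

end CyclotomicTeichmullerRing

theorem IsSkew.isSkewHadamardDifferenceSet {G : Type*} [AddGroup G] [Finite G] [DecidableEq G]
    {D : Finset G} (hD : IsSkew D) {k : ℕ}
    (hk : ∀ g ≠ 0, ((D ×ˢ D).filter fun d => d.1 - d.2 = g).card = k) :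
    IsSkewHadamardDifferenceSet (D : Set G) where
  isDifferenceSet := by
    refine ⟨_, _, k, rfl, rfl, fun g hg => ?_⟩
    rw [← hk g hg, ← Set.ncard_coe_finset]
    congr 1
    ext d
    simp only [Set.mem_ofPred_eq, Finset.coe_filter, Finset.mem_product, Finset.mem_coe]
    have hne (hd : d.1 - d.2 = g) : d.1 ≠ d.2 := fun heq => hg (by rw [← hd, heq, sub_self])
    tauto
  disjoint_neg := Set.disjoint_left.2 fun u hu => ((hD u).1 hu).2
  zero_notMem := hD.zero_notMem
  union_eq := by
    ext u
    simp only [Set.mem_union, Set.mem_neg, Finset.mem_coe, Set.mem_singleton_iff, Set.mem_univ,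
      iff_true]
    have hu := hD u
    tauto

theorem CyclotomicTeichmullerRing.isSkewHadamardDifferenceSet_of_pow_dvd {F R : Type*} [Field F]
    [Fintype F] [CharP F 3] [CommRing R] [IsDomain R] [CharZero R]
    (T : CyclotomicTeichmullerRing 3 F R) {D : Finset F} {h : ℕ}
    (hq : Fintype.card F = 3 ^ (2 * h + 1)) (hD : IsSkew D)
    (hdvd : ∀ b, (T.omega - 1) ^ (2 * h + 1) ∣ T.charSum D b - T.charSum D (-b)) :
    IsSkewHadamardDifferenceSet (D : Set F) := by
  classical
  have hnorm : ∀ b ≠ 0, 4 * (T.charSum D b * T.charSum D (-b)) = 1 + Fintype.card F := by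
    intro b hb
    rw [T.four_mul_charSum_mul_charSum_neg hD hb, ← Int.cast_pow,
      T.signedTraceSum_sq hq hD hdvd hb, hq]
    push_cast
    ring
  refine hD.isSkewHadamardDifferenceSet (k := (Fintype.card F - 3) / 4) fun g hg => ?_
  have hcount := T.four_mul_card_filter_sub_eq_add_three hD hnorm hg
  lia

theorem three_pow_two_mul_add_one_mod_four (h : ℕ) : 3 ^ (2 * h + 1) % 4 = 3 := by
  rw [pow_succ, pow_mul, Nat.mul_mod, Nat.pow_mod]
  norm_num

theorem theorem3p3 {F : Type*} [Field F] [Finite F] (h : ℕ)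
    (hq : Nat.card F = 3 ^ (2 * h + 1)) (a : F) (ha : a ≠ 0) :
    IsSkewHadamardDifferenceSet (reeTitsSet (3 ^ (h + 1)) a) := by
  classical
  have := Fintype.ofFinite F
  have hcard : Fintype.card F = 3 ^ (2 * h + 1) := Nat.card_eq_fintype_card.symm.trans hq
  have hp : Fact (Nat.Prime 3) := ⟨Nat.prime_three⟩
  have hchar : CharP F 3 := charP_of_card_eq_prime_pow hcard
  have hmod : Fintype.card F % 4 = 3 := hcard ▸ three_pow_two_mul_add_one_mod_four h
  have hinj := reeTitsMap_injective hq ha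
  have hodd := reeTitsMap_neg (Odd.pow (n := h + 1) (by decide : Odd 3)) a
  have hskew : IsSkew ((nonzeroSquares F).image (reeTitsMap (3 ^ (h + 1)) a)) :=
    (isSkew_nonzeroSquares hmod).image (Finite.injective_iff_bijective.1 hinj)
      (reeTitsMap_zero (by positivity) a) hodd
  obtain ⟨R, _, _, _, ⟨T⟩⟩ := exists_cyclotomicTeichmullerRing 3 F
  rw [← coe_image_reeTitsMap_nonzeroSquares]
  refine T.isSkewHadamardDifferenceSet_of_pow_dvd hcard hskew fun b => ?_
  rw [T.charSum_image_nonzeroSquares_sub hmod hinj hodd]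
  exact T.pow_dvd_reeTits_sum hcard a b
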